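/- Let $L$ be an SPS lattice, that is, a planar (hence finite) upper semimodular lattice with no sublattice isomorphic to $M_3$. Let $S=\{o,a_l,a_r,i\}$ be a covering square of $L$ ($o\prec a_l\prec i$, $o\prec a_r\prec i$, $a_l\neq a_r$) that is tight, that is, $a_l$ and $a_r$ are the only elements of $L$ covered by $i$. Let $L[S]$ be obtained from $L$ by inserting a fork at $S$: put $x_{l,1}=a_l$, $y_{l,1}=o$, and, as long as there is an $x_{l,k+1}\in L$ such that $\{y_{l,k+1}=x_{l,k+1}\wedge y_{l,k},\ x_{l,k+1},\ y_{l,k},\ x_{l,k}\}$ is a covering square of $L$ with top $x_{l,k}$, continue with the pair $(y_{l,k+1},x_{l,k+1})$; define $x_{r,k},y_{r,k}$ in the same way starting from $x_{r,1}=a_r$, $y_{r,1}=o$. Add to $L$ new elements $t$, $z_{l,k}$, $z_{r,k}$ (one for each $k$ for which $x_{l,k}$, respectively $x_{r,k}$, is defined), and let the order be generated by that of $L$ together with $z_{l,1}<t$, $z_{r,1}<t$, $t<i$, and, for $s\in\{l,r\}$, $y_{s,k}<z_{s,k}<x_{s,k}$ and $z_{s,k+1}<z_{s,k}$. Then $L[S]$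 is a lattice. Write $\operatorname{con}(a,b)$ for the smallest congruence of $L[S]$ collapsing $a$ and $b$, and let $\gamma(S)=\operatorname{con}(t,i)$, $\overline{\alpha}_l(S)=\operatorname{con}(a_l,i)$, $\overline{\alpha}_r(S)=\operatorname{con}(a_r,i)$. These three congruences are join-irreducible, and in the ordered set $\operatorname{Ji}(\operatorname{Con} L[S])$ of join-irreducible congruences of $L[S]$ the covers of $\gamma(S)$ are exactly the minimal elements of $\{\overline{\alpha}_l(S),\overline{\alpha}_r(S)\}$. In particular, $\gamma(S)$ has one or two covers there: both $\overline{\alpha}_l(S)$ and $\overline{\alpha}_r(S)$ are covers (possibly equal), unless one of them is strictly below the other, and then the smaller one is the only cover. -/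

import Mathlib

/-! ### Slim, planar, semimodular lattices -/

/-- A finite ordered set is planar if it has a planar (Hasse) diagram: the elements are distinct
points of the plane, smaller elements are drawn lower, every covering pair is joined by a straight
line segment, and two different such segments meet at most in a common endpoint. -/
def IsPlanar (P : Type*) [PartialOrder P] : Prop :=
  Finite P ∧ ∃ pos : P → ℝ × ℝ, Function.Injective pos ∧
    (∀ a b : P, a < b → (pos a).2 < (pos b).2) ∧
    ∀ a b c d : P, a ⋖ b → c ⋖ d → (a, b) ≠ (c, d) →
      segment ℝ (pos a) (pos b) ∩ segment ℝ (pos c) (pos d) ⊆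
        pos '' (({a, b} : Set P) ∩ {c, d})

/-- A lattice is slim if it has no five-element sublattice `{o, a, b, c, i}` isomorphic to `M₃`. -/
def IsSlim (L : Type*) [Lattice L] : Prop :=
  ¬ ∃ o a b c i : L, a ≠ b ∧ a ≠ c ∧ b ≠ c ∧
    a ⊓ b = o ∧ a ⊓ c = o ∧ b ⊓ c = o ∧ a ⊔ b = i ∧ a ⊔ c = i ∧ b ⊔ c = i

/-- SPS lattices: slim, planar (in particular finite), (upper) semimodular lattices. -/
structure IsSPS (L : Type*) [Lattice L] : Prop where
  slim : IsSlim L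
  planar : IsPlanar L
  semimodular : IsUpperModularLattice L

/-! ### Covering squares -/

/-- `{o, a, b, i}` is a covering square with bottom `o`, top `i` and the two middle elements
`a ≠ b` (so that `o = a ⊓ b` and `i = a ⊔ b`). -/
def IsCoveringSquare {L : Type*} [Lattice L] (o a b i : L) : Prop :=
  o ⋖ a ∧ o ⋖ b ∧ a ⋖ i ∧ b ⋖ i ∧ a ≠ b

/-- A covering square `S = {o, a_l, a_r, i}` of `L`. -/
structure CoveringSquare (L : Type*) [Lattice L] where
  /-- the bottom -/
  o : L
  /-- the left middle element -/
  al : L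
  /-- the right middle element -/
  ar : L
  /-- the top -/
  i : L
  isCoveringSquare : IsCoveringSquare o al ar i

/-- `S` is tight if its top `i` covers exactly two elements of `L`, namely `a_l` and `a_r`. -/
def CoveringSquare.IsTight {L : Type*} [Lattice L] (S : CoveringSquare L) : Prop :=
  ∀ x : L, x ⋖ S.i ↔ x = S.al ∨ x = S.ar

/-! ### Inserting a fork -/

/-- `ForkTrace o a y x` says that `(y, x)` is one of the pairs `(y₁, x₁), (y₂, x₂), …`, where
`(y₁, x₁) = (o, a)` and `(yₖ₊₁, xₖ₊₁)` is obtained from `(yₖ, xₖ)` whenever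
`{yₖ₊₁ = xₖ₊₁ ⊓ yₖ, xₖ₊₁, yₖ, xₖ}` is a covering square of `L`. -/
inductive ForkTrace {L : Type*} [Lattice L] (o a : L) : L → L → Prop
  | base : ForkTrace o a o a
  | step {y x x' : L} (h : ForkTrace o a y x) (hT : IsCoveringSquare (x' ⊓ y) x' y x) :
      ForkTrace o a (x' ⊓ y) x'

/-- The elements of `L[S]`: the elements of `L`, the new element `t`, and the new elements
`z_{l,k}` and `z_{r,k}`; the element `z_{l,k}` (resp. `z_{r,k}`) is named by the edge
`y_{l,k} ⋖ x_{l,k}` (resp. `y_{r,k} ⋖ x_{r,k}`) of `L` that it subdivides. -/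
inductive Fork {L : Type*} [Lattice L] (S : CoveringSquare L) : Type _
  | old (a : L) : Fork S
  | t : Fork S
  | zl (y x : L) (h : ForkTrace S.o S.al y x) : Fork S
  | zr (y x : L) (h : ForkTrace S.o S.ar y x) : Fork S

/-- The order relations imposed when the fork is inserted: those of `L`, the relations
`z_{l,1} < t`, `z_{r,1} < t`, `t < i`, and, on both sides, `y_k < z_k < x_k`, `z_{k+1} < z_k`. -/
inductive Fork.Step {L : Type*} [Lattice L] (S : CoveringSquare L) : Fork S → Fork S → Prop
  | old {a b : L} (h : a ≤ b) : Fork.Step S (.old a) (.old b)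
  | t_lt_i : Fork.Step S .t (.old S.i)
  | zl_lt_t : Fork.Step S (.zl S.o S.al .base) .t
  | zr_lt_t : Fork.Step S (.zr S.o S.ar .base) .t
  | y_lt_zl {y x : L} (h : ForkTrace S.o S.al y x) : Fork.Step S (.old y) (.zl y x h)
  | y_lt_zr {y x : L} (h : ForkTrace S.o S.ar y x) : Fork.Step S (.old y) (.zr y x h)
  | zl_lt_x {y x : L} (h : ForkTrace S.o S.al y x) : Fork.Step S (.zl y x h) (.old x)
  | zr_lt_x {y x : L} (h : ForkTrace S.o S.ar y x) : Fork.Step S (.zr y x h) (.old x)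
  | zl_lt_zl {y x x' : L} (h : ForkTrace S.o S.al y x)
      (hT : IsCoveringSquare (x' ⊓ y) x' y x) :
      Fork.Step S (.zl (x' ⊓ y) x' (h.step hT)) (.zl y x h)
  | zr_lt_zr {y x x' : L} (h : ForkTrace S.o S.ar y x)
      (hT : IsCoveringSquare (x' ⊓ y) x' y x) :
      Fork.Step S (.zr (x' ⊓ y) x' (h.step hT)) (.zr y x h)

/-- The order of `L[S]`: the reflexive and transitive closure of the imposed relations. -/
def Fork.Le {L : Type*} [Lattice L] {S : CoveringSquare L} (u v : Fork S) : Prop :=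
  Relation.ReflTransGen (Fork.Step S) u v

/-! ### The congruence lattice -/

/-- Congruences are ordered by inclusion. -/
instance LatticeCon.instPartialOrder {K : Type*} [Lattice K] : PartialOrder (LatticeCon K) where
  le θ φ := ∀ x y : K, θ.r x y → φ.r x y
  le_refl _ _ _ h := h
  le_trans _ _ _ h₁ h₂ x y h := h₂ x y (h₁ x y h)
  le_antisymm θ φ h₁ h₂ := by
    rcases θ with ⟨⟨r, e⟩, i, s⟩
    rcases φ with ⟨⟨r', e'⟩, i', s'⟩
    have hr : r = r' := by
      funext x y
      exact propext ⟨h₁ x y, h₂ x y⟩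
    subst hr
    rfl

/-- The intersection of a set of congruences. -/
instance LatticeCon.instInfSet {K : Type*} [Lattice K] : InfSet (LatticeCon K) where
  sInf A :=
    { r := fun x y => ∀ θ ∈ A, θ.r x y
      iseqv := ⟨fun x θ _ => θ.iseqv.refl x, fun h θ hθ => θ.iseqv.symm (h θ hθ),
        fun h h' θ hθ => θ.iseqv.trans (h θ hθ) (h' θ hθ)⟩
      inf := fun h h' θ hθ => θ.inf (h θ hθ) (h' θ hθ)
      sup := fun h h' θ hθ => θ.sup (h θ hθ) (h' θ hθ) }

/-- The congruence lattice `Con K`. -/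
instance LatticeCon.instCompleteLattice {K : Type*} [Lattice K] :
    CompleteLattice (LatticeCon K) :=
  completeLatticeOfInf _ fun _ =>
    ⟨fun _ hθ _ _ h => h _ hθ, fun _ hφ x y h _ hθ => hφ hθ x y h⟩

/-- `con(a, b)`, the smallest congruence of `K` collapsing `a` and `b`. -/
def LatticeCon.con {K : Type*} [Lattice K] (a b : K) : LatticeCon K :=
  sInf {θ : LatticeCon K | θ.r a b}

/-- `Ji (Con K)`, the ordered set of join-irreducible congruences of `K`. -/
abbrev JiCon (K : Type*) [Lattice K] : Type _ :=
  {θ : LatticeCon K // SupIrred θ}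

/-!
Two facts about `L` carry the argument: planarity places one of any three pairwise incomparable
elements between the meet and the join of the other two, and with slimness and semimodularity this
leaves every element at most two covers.

Sending `u` to the least element of `L` above `u`, together with whether `u ≰ t`, embeds `L[S]` in
the product of `L` with a two-element chain. The image is closed under joins, so `L[S]` is a finite
join-semilattice with a least element, hence a lattice.

Perspectivity gives `con(t, i) ≤ con(a_s, i)` for both middle elements `a_s` of `S`. The inequality
is strict: call `a_l`, `a_r` and the elements of `L` not properly below `i` barriers; then lying
below the same barriers is a congruence of `L[S]` that collapses `t` with `i` but neither `a_l` nor
`a_r` with `i`.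

Finally, let a congruence `δ` collapse `t` with `i` but neither `a_l` nor `a_r` with `i`. Then the
pairs of `δ` that are not separated by the ideal of `t` form a congruence, and `δ` is the join of
this congruence with `con(t, i)`. If `δ` is join-irreducible, it is therefore `con(t, i)`. Hence
every join-irreducible congruence properly above `con(t, i)` lies above some `con(a_s, i)`.
-/

/-! ### Planar diagrams -/

/-- `pos` places the elements of `P` in the plane as the vertices of a planar (Hasse) diagram; the
second coordinate is the height. -/
structure IsDiagram {P : Type*} [PartialOrder P] (pos : P → ℝ × ℝ) : Prop where
  height_lt : ∀ a b : P, a < b → (pos a).2 < (pos b).2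
  segment_inter : ∀ a b c d : P, a ⋖ b → c ⋖ d → (a, b) ≠ (c, d) →
    segment ℝ (pos a) (pos b) ∩ segment ℝ (pos c) (pos d) ⊆ pos '' (({a, b} : Set P) ∩ {c, d})

/-- `f` describes, as a function of the height, the polygonal line that a diagram draws for a
maximal chain `C` of the interval `[a, b]`. -/
structure IsTrack {P : Type*} [PartialOrder P] (pos : P → ℝ × ℝ) (a b : P) (C : Set P)
    (f : ℝ → ℝ) : Prop where
  continuous : Continuous f
  left_mem : a ∈ C
  right_mem : b ∈ C
  subset_Icc : C ⊆ Set.Icc a b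
  isChain : IsChain (· ≤ ·) C
  apply_vertex : ∀ c ∈ C, f (pos c).2 = (pos c).1
  exists_edge : ∀ s ∈ Set.Icc (pos a).2 (pos b).2, ∃ p ∈ C, ∃ q ∈ C, p ⋖ q ∧
    s ∈ Set.Icc (pos p).2 (pos q).2 ∧ (f s, s) ∈ segment ℝ (pos p) (pos q)

section Diagram

variable {P : Type*} [PartialOrder P] {pos : P → ℝ × ℝ} {a b c u v : P} {C D : Set P} {f g : ℝ → ℝ}

namespace IsDiagram

lemma height_le (hpos : IsDiagram pos) (h : a ≤ b) : (pos a).2 ≤ (pos b).2 := by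
  rcases h.eq_or_lt with rfl | h
  · rfl
  · exact (hpos.height_lt _ _ h).le

lemma le_of_isChain (hpos : IsDiagram pos) (hC : IsChain (· ≤ ·) C) (ha : a ∈ C) (hb : b ∈ C)
    (h : (pos a).2 ≤ (pos b).2) : a ≤ b := by
  rcases hC.total ha hb with hab | hba
  · exact hab
  · rcases hba.eq_or_lt with rfl | hlt
    · rfl
    · exact absurd (hpos.height_lt _ _ hlt) h.not_gt

lemma exists_isTrack_of_covBy (hpos : IsDiagram pos) (h : a ⋖ b) : ∃ C f, IsTrack pos a b C f := by
  have hlt := hpos.height_lt _ _ h.lt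
  have hne : (pos b).2 - (pos a).2 ≠ 0 := by linarith
  refine ⟨{a, b}, fun s => AffineMap.lineMap (pos a).1 (pos b).1
    ((s - (pos a).2) / ((pos b).2 - (pos a).2)), ?_, .inl rfl, .inr rfl, ?_, .pair h.le, ?_, ?_⟩
  · simp only [AffineMap.lineMap_apply_ring']
    fun_prop
  · rintro c (rfl | rfl)
    · exact ⟨le_rfl, h.le⟩
    · exact ⟨h.le, le_rfl⟩
  · rintro c (rfl | rfl)
    · simp
    · simp [div_self hne]
  · rintro s ⟨hs, hs'⟩
    refine ⟨a, .inl rfl, b, .inr rfl, h, ⟨hs, hs'⟩, ?_⟩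
    rw [segment_eq_image_lineMap]
    refine ⟨(s - (pos a).2) / ((pos b).2 - (pos a).2), ⟨?_, ?_⟩, ?_⟩
    · exact div_nonneg (by linarith) (by linarith)
    · exact (div_le_one (by linarith)).2 (by linarith)
    · ext
      · simp [AffineMap.lineMap_apply]
      · simp [AffineMap.lineMap_apply, div_mul_cancel₀ _ hne]

lemma exists_isTrack_union (hpos : IsDiagram pos) (hf : IsTrack pos a b C f)
    (hg : IsTrack pos b c D g) : ∃ k, IsTrack pos a c (C ∪ D) k := by
  have hfg : f (pos b).2 = g (pos b).2 := by
    rw [hf.apply_vertex b hf.right_mem, hg.apply_vertex b hg.left_mem]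
  have hab := (hf.subset_Icc hf.left_mem).2
  have hbc := (hg.subset_Icc hg.left_mem).2
  have eq_f : ∀ s ≤ (pos b).2, (if s ≤ (pos b).2 then f s else g s) = f s :=
    fun s hs => if_pos hs
  have eq_g : ∀ s ≥ (pos b).2, (if s ≤ (pos b).2 then f s else g s) = g s := by
    intro s hs
    split_ifs with hs'
    · rwa [le_antisymm hs' hs]
    · rfl
  refine ⟨fun s => if s ≤ (pos b).2 then f s else g s, ?_, .inl hf.left_mem, .inr hg.right_mem,
    ?_, ?_, ?_, ?_⟩
  · refine hf.continuous.if_le hg.continuous continuous_id continuous_const ?_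
    rintro s rfl
    exact hfg
  · exact Set.union_subset (hf.subset_Icc.trans (Set.Icc_subset_Icc_right hbc))
      (hg.subset_Icc.trans (Set.Icc_subset_Icc_left hab))
  · exact isChain_union.2 ⟨hf.isChain, hg.isChain, fun d hd e he _ =>
      .inl ((hf.subset_Icc hd).2.trans (hg.subset_Icc he).1)⟩
  · rintro d (hd | hd)
    · exact (eq_f _ (hpos.height_le (hf.subset_Icc hd).2)).trans (hf.apply_vertex d hd)
    · exact (eq_g _ (hpos.height_le (hg.subset_Icc hd).1)).trans (hg.apply_vertex d hd)
  · rintro s ⟨hs, hs'⟩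
    rcases le_total s (pos b).2 with hsb | hsb
    · obtain ⟨p, hp, q, hq, hpq⟩ := hf.exists_edge s ⟨hs, hsb⟩
      exact ⟨p, .inl hp, q, .inl hq, by simpa only [eq_f s hsb] using hpq⟩
    · obtain ⟨p, hp, q, hq, hpq⟩ := hg.exists_edge s ⟨hsb, hs'⟩
      exact ⟨p, .inr hp, q, .inr hq, by simpa only [eq_g s hsb] using hpq⟩

lemma exists_isTrack_of_lt [Finite P] (hpos : IsDiagram pos) (h : a < b) :
    ∃ C f, IsTrack pos a b C f := by
  classical
  have := Fintype.ofFinite P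
  have : LocallyFiniteOrder P := Fintype.toLocallyFiniteOrder
  induction transGen_covBy_of_lt h with
  | single hab => exact hpos.exists_isTrack_of_covBy hab
  | tail hac hcd ih =>
    obtain ⟨C, f, hf⟩ := ih (lt_iff_transGen_covBy.2 hac)
    obtain ⟨D, g, hg⟩ := hpos.exists_isTrack_of_covBy hcd
    exact ⟨_, hpos.exists_isTrack_union hf hg⟩

lemma exists_isTrack_through [Finite P] (hpos : IsDiagram pos) (hau : a < u) (huv : u ≤ v)
    (hvb : v < b) : ∃ C f, IsTrack pos a b C f ∧ u ∈ C ∧ v ∈ C := by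
  obtain ⟨C, f, hf⟩ := hpos.exists_isTrack_of_lt hau
  obtain ⟨D, g, hg⟩ := hpos.exists_isTrack_of_lt hvb
  rcases huv.eq_or_lt with rfl | huv
  · obtain ⟨k, hk⟩ := hpos.exists_isTrack_union hf hg
    exact ⟨_, k, hk, .inl hf.right_mem, .inl hf.right_mem⟩
  · obtain ⟨E, e, he⟩ := hpos.exists_isTrack_of_lt huv
    obtain ⟨k, hk⟩ := hpos.exists_isTrack_union hf he
    obtain ⟨l, hl⟩ := hpos.exists_isTrack_union hk hg
    exact ⟨_, l, hl, .inl (.inl hf.right_mem), .inl (.inr he.right_mem)⟩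

end IsDiagram

namespace IsTrack

-- On a common edge `p ⋖ q` the elements would satisfy `u ≤ q` and `p ≤ v`, forcing `u = q ≥ v`;
-- two different edges could only meet at a vertex `z`, and then `u ≤ z ≤ v`.
lemma apply_ne_of_le (hpos : IsDiagram pos) (hf : IsTrack pos a b C f) (hg : IsTrack pos a b D g)
    (hu : u ∈ C) (hv : v ∈ D) (huv : IncompRel (· ≤ ·) u v) {s : ℝ} (hus : (pos u).2 ≤ s)
    (hsv : s ≤ (pos v).2) : f s ≠ g s := by
  intro hfg
  have hs : s ∈ Set.Icc (pos a).2 (pos b).2 :=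
    ⟨(hpos.height_le (hf.subset_Icc hu).1).trans hus,
      hsv.trans (hpos.height_le (hg.subset_Icc hv).2)⟩
  have le_of_mem_C : ∀ z ∈ C, s ≤ (pos z).2 → u ≤ z := fun z hz hsz =>
    hpos.le_of_isChain hf.isChain hu hz (hus.trans hsz)
  have le_of_mem_D : ∀ z ∈ D, (pos z).2 ≤ s → z ≤ v := fun z hz hzs =>
    hpos.le_of_isChain hg.isChain hz hv (hzs.trans hsv)
  obtain ⟨p, hp, q, hq, hpq, ⟨hps, hsq⟩, hmem⟩ := hf.exists_edge s hs
  obtain ⟨p', hp', q', hq', hpq', ⟨hps', -⟩, hmem'⟩ := hg.exists_edge s hs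
  by_cases he : (p, q) = (p', q')
  · obtain ⟨rfl, rfl⟩ := Prod.mk.inj he
    have huq := le_of_mem_C q hq hsq
    have hpv := le_of_mem_D p hp' hps'
    have hpu := (hf.isChain.total hp hu).resolve_right fun h => huv.not_le (h.trans hpv)
    have hvq := (hg.isChain.total hv hq').resolve_right fun h => huv.not_le (huq.trans h)
    rcases hpq.eq_or_eq hpu huq with rfl | rfl
    · exact huv.not_le hpv
    · exact huv.not_ge hvq
  · rw [← hfg] at hmem'
    obtain ⟨z, ⟨hz, hz'⟩, hzs⟩ := hpos.segment_inter p q p' q' hpq hpq' he ⟨hmem, hmem'⟩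
    have hheight : (pos z).2 = s := by rw [hzs]
    have hzC : z ∈ C := by rcases hz with rfl | rfl <;> assumption
    have hzD : z ∈ D := by rcases hz' with rfl | rfl <;> assumption
    exact huv.not_le ((le_of_mem_C z hzC hheight.ge).trans (le_of_mem_D z hzD hheight.le))

lemma apply_ne (hpos : IsDiagram pos) (hf : IsTrack pos a b C f) (hg : IsTrack pos a b D g)
    (hu : u ∈ C) (hv : v ∈ D) (huv : IncompRel (· ≤ ·) u v) {s : ℝ}
    (hs : s ∈ Set.uIcc (pos u).2 (pos v).2) : f s ≠ g s := by
  rcases Set.mem_uIcc.1 hs with ⟨hus, hsv⟩ | ⟨hvs, hsu⟩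
  · exact apply_ne_of_le hpos hf hg hu hv huv hus hsv
  · exact (apply_ne_of_le hpos hg hf hv hu huv.symm hvs hsu).symm

lemma apply_lt_of_apply_lt (hpos : IsDiagram pos) (hf : IsTrack pos a b C f)
    (hg : IsTrack pos a b D g) (hu : u ∈ C) (hv : v ∈ D) (huv : IncompRel (· ≤ ·) u v) {s s' : ℝ}
    (hs : s ∈ Set.uIcc (pos u).2 (pos v).2) (hs' : s' ∈ Set.uIcc (pos u).2 (pos v).2)
    (h : f s < g s) : f s' < g s' := by
  by_contra hle
  have hcont : ContinuousOn (fun r => g r - f r) (Set.uIcc s s') :=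
    (hg.continuous.sub hf.continuous).continuousOn
  have hzero : (0 : ℝ) ∈ Set.uIcc (g s - f s) (g s' - f s') :=
    Set.mem_uIcc.2 (.inr ⟨by linarith, by linarith⟩)
  obtain ⟨r, hr, hr0⟩ := intermediate_value_uIcc hcont hzero
  exact apply_ne hpos hf hg hu hv huv (Set.uIcc_subset_uIcc hs hs' hr) (sub_eq_zero.1 hr0).symm

end IsTrack

end Diagram

/-- The vertex `u` is drawn to the left of some maximal chain through `v`. It is only used for
incomparable `u` and `v`, where it does not depend on the chain (`LeftOf.apply_lt`). -/
def LeftOf {P : Type*} [PartialOrder P] [BoundedOrder P] (pos : P → ℝ × ℝ) (u v : P) : Prop :=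
  ∃ D g, IsTrack pos ⊥ ⊤ D g ∧ v ∈ D ∧ (pos u).1 < g (pos u).2

section LeftOf

variable {P : Type*} [PartialOrder P] [BoundedOrder P] {pos : P → ℝ × ℝ} {u v w : P}

lemma LeftOf.apply_lt (hpos : IsDiagram pos) (h : LeftOf pos u v) (huv : IncompRel (· ≤ ·) u v)
    {C D : Set P} {f g : ℝ → ℝ} (hf : IsTrack pos ⊥ ⊤ C f) (hg : IsTrack pos ⊥ ⊤ D g) (hu : u ∈ C)
    (hv : v ∈ D) {s : ℝ} (hs : s ∈ Set.uIcc (pos u).2 (pos v).2) : f s < g s := by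
  obtain ⟨E, e, he, hvE, hlt⟩ := h
  have hlt_v : f (pos v).2 < g (pos v).2 := by
    rw [hg.apply_vertex v hv, ← he.apply_vertex v hvE]
    rw [← hf.apply_vertex u hu] at hlt
    exact hf.apply_lt_of_apply_lt hpos he hu hvE huv Set.left_mem_uIcc Set.right_mem_uIcc hlt
  exact hf.apply_lt_of_apply_lt hpos hg hu hv huv Set.right_mem_uIcc hs hlt_v

variable [Finite P]

lemma IsDiagram.exists_isTrack_of_incompRel (hpos : IsDiagram pos) (huv : IncompRel (· ≤ ·) u v)
    (huw : IncompRel (· ≤ ·) u w) (hvw : Relation.SymmGen (· ≤ ·) v w) :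
    ∃ D g, IsTrack pos ⊥ ⊤ D g ∧ v ∈ D ∧ w ∈ D := by
  have bot_lt : ∀ x, IncompRel (· ≤ ·) u x → ⊥ < x := fun x hx =>
    bot_lt_iff_ne_bot.2 (by rintro rfl; exact hx.not_ge bot_le)
  have lt_top : ∀ x, IncompRel (· ≤ ·) u x → x < ⊤ := fun x hx =>
    lt_top_iff_ne_top.2 (by rintro rfl; exact hx.not_le le_top)
  rcases hvw with hle | hle
  · exact hpos.exists_isTrack_through (bot_lt v huv) hle (lt_top w huw)
  · obtain ⟨D, g, hg, hw, hv⟩ := hpos.exists_isTrack_through (bot_lt w huw) hle (lt_top v huv)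
    exact ⟨D, g, hg, hv, hw⟩

lemma IsDiagram.leftOf_or_leftOf (hpos : IsDiagram pos) (huv : IncompRel (· ≤ ·) u v) :
    LeftOf pos u v ∨ LeftOf pos v u := by
  obtain ⟨C, f, hf, hu, -⟩ := hpos.exists_isTrack_of_incompRel huv.symm huv.symm .rfl
  obtain ⟨D, g, hg, hv, -⟩ := hpos.exists_isTrack_of_incompRel huv huv .rfl
  rcases lt_or_gt_of_ne (hf.apply_ne hpos hg hu hv huv Set.left_mem_uIcc) with h | h
  · exact .inl ⟨D, g, hg, hv, by rwa [← hf.apply_vertex u hu]⟩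
  · refine .inr ⟨C, f, hf, hu, ?_⟩
    rw [← hg.apply_vertex v hv]
    exact hg.apply_lt_of_apply_lt hpos hf hv hu huv.symm Set.right_mem_uIcc Set.left_mem_uIcc h

namespace LeftOf

lemma not_leftOf (hpos : IsDiagram pos) (h : LeftOf pos u v) (huv : IncompRel (· ≤ ·) u v) :
    ¬ LeftOf pos v u := by
  intro h'
  obtain ⟨C, f, hf, hu, -⟩ := hpos.exists_isTrack_of_incompRel huv.symm huv.symm .rfl
  obtain ⟨D, g, hg, hv, -⟩ := hpos.exists_isTrack_of_incompRel huv huv .rfl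
  exact lt_asymm (h.apply_lt hpos huv hf hg hu hv Set.left_mem_uIcc)
    (h'.apply_lt hpos huv.symm hg hf hv hu Set.right_mem_uIcc)

lemma of_symmGen_right (hpos : IsDiagram pos) (h : LeftOf pos u v) (huv : IncompRel (· ≤ ·) u v)
    (huw : IncompRel (· ≤ ·) u w) (hvw : Relation.SymmGen (· ≤ ·) v w) : LeftOf pos u w := by
  obtain ⟨C, f, hf, hu, -⟩ := hpos.exists_isTrack_of_incompRel huv.symm huv.symm .rfl
  obtain ⟨D, g, hg, hv, hw⟩ := hpos.exists_isTrack_of_incompRel huv huw hvw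
  refine ⟨D, g, hg, hw, ?_⟩
  rw [← hf.apply_vertex u hu]
  exact h.apply_lt hpos huv hf hg hu hv Set.left_mem_uIcc

lemma of_symmGen_left (hpos : IsDiagram pos) (h : LeftOf pos v u) (huv : IncompRel (· ≤ ·) u v)
    (huw : IncompRel (· ≤ ·) u w) (hvw : Relation.SymmGen (· ≤ ·) v w) : LeftOf pos w u :=
  (hpos.leftOf_or_leftOf huw).resolve_left fun h' =>
    h.not_leftOf hpos huv.symm (h'.of_symmGen_right hpos huw huv hvw.symm)

lemma symmGen_of_symmGen (hpos : IsDiagram pos) {a b c m : P} (hab : LeftOf pos a b)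
    (hbc : LeftOf pos b c) (hab' : IncompRel (· ≤ ·) a b) (hbc' : IncompRel (· ≤ ·) b c)
    (ham : Relation.SymmGen (· ≤ ·) a m) (hcm : Relation.SymmGen (· ≤ ·) c m) :
    Relation.SymmGen (· ≤ ·) m b := by
  by_contra hmb
  rw [not_symmGen_iff] at hmb
  exact (hab.of_symmGen_left hpos hab'.symm hmb.symm ham).not_leftOf hpos hmb
    (hbc.of_symmGen_right hpos hbc' hmb.symm hcm)

lemma inf_le_and_le_sup {L : Type*} [Lattice L] [BoundedOrder L] [Finite L] {pos : L → ℝ × ℝ}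
    (hpos : IsDiagram pos) {a b c : L} (hab : LeftOf pos a b) (hbc : LeftOf pos b c)
    (hab' : IncompRel (· ≤ ·) a b) (hbc' : IncompRel (· ≤ ·) b c) : a ⊓ c ≤ b ∧ b ≤ a ⊔ c :=
  ⟨(hab.symmGen_of_symmGen hpos hbc hab' hbc' (.of_ge inf_le_left)
      (.of_ge inf_le_right)).resolve_right fun h => hab'.not_ge (h.trans inf_le_left),
    (hab.symmGen_of_symmGen hpos hbc hab' hbc' (.of_le le_sup_left)
      (.of_le le_sup_right)).resolve_left fun h => hab'.not_le (le_sup_left.trans h)⟩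

end LeftOf

end LeftOf

section Planar

variable {L : Type*} [Lattice L] {a b c : L}

theorem IsPlanar.exists_middle (hL : IsPlanar L) (hab : IncompRel (· ≤ ·) a b)
    (hac : IncompRel (· ≤ ·) a c) (hbc : IncompRel (· ≤ ·) b c) :
    (a ⊓ b ≤ c ∧ c ≤ a ⊔ b) ∨ (a ⊓ c ≤ b ∧ b ≤ a ⊔ c) ∨ (b ⊓ c ≤ a ∧ a ≤ b ⊔ c) := by
  obtain ⟨_, pos, -, hheight, hinter⟩ := hL
  have hpos : IsDiagram pos := ⟨hheight, hinter⟩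
  have := Fintype.ofFinite L
  have : Nonempty L := ⟨a⟩
  have := Fintype.toBoundedOrder L
  have middle {x y z : L} (hxy : LeftOf pos x y) (hyz : LeftOf pos y z) :=
    hxy.inf_le_and_le_sup hpos hyz
  rcases hpos.leftOf_or_leftOf hab with h | h <;> rcases hpos.leftOf_or_leftOf hbc with k | k
  · exact .inr (.inl (middle h k hab hbc))
  · rcases hpos.leftOf_or_leftOf hac with l | l
    · exact .inl (middle l k hac hbc.symm)
    · rw [inf_comm b, sup_comm b]
      exact .inr (.inr (middle l h hac.symm hab))
  · rcases hpos.leftOf_or_leftOf hac with l | l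
    · exact .inr (.inr (middle h l hab.symm hac))
    · rw [inf_comm a b, sup_comm a b]
      exact .inl (middle k l hbc hac.symm)
  · rw [inf_comm a c, sup_comm a c]
    exact .inr (.inl (middle k h hbc.symm hab.symm))

end Planar

/-! ### Upper covers in slim, planar, semimodular lattices -/

section CovBy

variable {L : Type*} [Lattice L] {o a b c w x y : L}

lemma not_le_of_covBy_of_covBy (ha : o ⋖ a) (hb : o ⋖ b) (h : a ≠ b) : ¬ a ≤ b :=
  fun hab => h (hab.eq_of_not_lt fun hlt => hb.2 ha.lt hlt)

lemma inf_eq_of_covBy_of_not_le (ha : o ⋖ a) (hb : o ≤ b) (h : ¬ a ≤ b) : a ⊓ b = o :=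
  (ha.eq_or_eq (le_inf ha.le hb) inf_le_left).resolve_right fun e => h (inf_eq_left.1 e)

section IsUpperModularLattice

variable [IsUpperModularLattice L]

lemma covBy_sup_of_covBy_of_not_le (ha : o ⋖ a) (hb : o ≤ b) (h : ¬ a ≤ b) : b ⋖ a ⊔ b :=
  covBy_sup_of_inf_covBy_left ((inf_eq_of_covBy_of_not_le ha hb h).symm ▸ ha)

lemma sup_eq_sup_of_covBy_of_le_sup (ha : o ⋖ a) (hb : o ⋖ b) (hc : o ⋖ c) (hab : a ≠ b)
    (hac : a ≠ c) (h : c ≤ a ⊔ b) : a ⊔ c = a ⊔ b := by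
  have ha_sup : a ⋖ a ⊔ b :=
    sup_comm b a ▸ covBy_sup_of_covBy_of_not_le hb ha.le (not_le_of_covBy_of_covBy hb ha hab.symm)
  exact (ha_sup.eq_or_eq le_sup_left (sup_le le_sup_left h)).resolve_left fun e =>
    not_le_of_covBy_of_covBy hc ha hac.symm (sup_eq_left.1 e)

lemma exists_isCoveringSquare_of_inf_covBy [IsStronglyCoatomic L] (hyx : y ⋖ x) (hwx : w < x)
    (hwy : ¬ w ≤ y) (hw : w ⊓ y ⋖ w) : ∃ x', w ≤ x' ∧ IsCoveringSquare (x' ⊓ y) x' y x := by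
  have hlt : w ⊓ y < y := inf_lt_right.2 fun hyw =>
    (hyx.eq_or_eq hyw hwx.le).elim (fun e => hwy e.le) hwx.ne
  obtain ⟨c, hwc, hcy⟩ := exists_le_covBy_of_lt hlt
  have hcov : c ⋖ w ⊔ c := covBy_sup_of_covBy_of_not_le hw hwc fun h => hwy (h.trans hcy.le)
  have hnot : ¬ w ⊔ c ≤ y := fun h => hwy (le_sup_left.trans h)
  have hinf : (w ⊔ c) ⊓ y = c := inf_eq_of_covBy_of_not_le hcov hcy.le hnot
  have hsup : y ⊔ (w ⊔ c) = x :=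
    (hyx.eq_or_eq le_sup_left (sup_le hyx.le (sup_le hwx.le (hcy.le.trans hyx.le)))).resolve_left
      fun e => hnot (sup_eq_left.1 e)
  have hcov_top : w ⊔ c ⋖ x :=
    hsup ▸ covBy_sup_of_covBy_of_not_le hcy hcov.le fun h => hcy.ne (hinf ▸ inf_eq_right.2 h)
  exact ⟨w ⊔ c, le_sup_left, by rwa [hinf], by rwa [hinf], hcov_top, hyx, fun e => hnot e.le⟩

end IsUpperModularLattice

end CovBy

namespace IsSPS

variable {L : Type*} [Lattice L] {o a b c d m : L}

lemma not_le_sup_of_covBy (hL : IsSPS L) (ha : o ⋖ a) (hb : o ⋖ b) (hc : o ⋖ c) (hab : a ≠ b)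
    (hac : a ≠ c) (hbc : b ≠ c) : ¬ c ≤ a ⊔ b := by
  intro h
  have := hL.semimodular
  have hac_sup : a ⊔ c = a ⊔ b := sup_eq_sup_of_covBy_of_le_sup ha hb hc hab hac h
  have hbc_sup : b ⊔ c = a ⊔ b :=
    sup_comm b a ▸ sup_eq_sup_of_covBy_of_le_sup hb ha hc hab.symm hbc (sup_comm a b ▸ h)
  exact hL.slim ⟨o, a, b, c, a ⊔ b, hab, hac, hbc, ha.wcovBy.inf_eq hb.wcovBy hab,
    ha.wcovBy.inf_eq hc.wcovBy hac, hb.wcovBy.inf_eq hc.wcovBy hbc, rfl, hac_sup, hbc_sup⟩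

theorem eq_or_eq_or_eq_of_covBy (hL : IsSPS L) (ha : o ⋖ a) (hb : o ⋖ b) (hc : o ⋖ c) :
    a = b ∨ a = c ∨ b = c := by
  by_contra! hne
  obtain ⟨hab, hac, hbc⟩ := hne
  have incomp {x y : L} (hx : o ⋖ x) (hy : o ⋖ y) (h : x ≠ y) : IncompRel (· ≤ ·) x y :=
    ⟨not_le_of_covBy_of_covBy hx hy h, not_le_of_covBy_of_covBy hy hx h.symm⟩
  rcases hL.planar.exists_middle (incomp ha hb hab) (incomp ha hc hac) (incomp hb hc hbc)
    with h | h | h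
  · exact hL.not_le_sup_of_covBy ha hb hc hab hac hbc h.2
  · exact hL.not_le_sup_of_covBy ha hc hb hac hab hbc.symm h.2
  · exact hL.not_le_sup_of_covBy hb hc ha hbc hab.symm hac.symm h.2

lemma exists_covBy_le (hL : IsSPS L) (h : a < b) : ∃ c, a ⋖ c ∧ c ≤ b := by
  have := hL.planar.1
  exact exists_covBy_le_of_lt h

lemma le_or_le_of_lt (hL : IsSPS L) (hc : o ⋖ c) (hd : o ⋖ d) (hcd : c ≠ d) (hb : o < b) :
    c ≤ b ∨ d ≤ b := by
  obtain ⟨e, he, heb⟩ := hL.exists_covBy_le hb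
  rcases hL.eq_or_eq_or_eq_of_covBy hc hd he with h | rfl | rfl
  · exact absurd h hcd
  · exact .inl heb
  · exact .inr heb

theorem le_or_le_of_not_le (hL : IsSPS L) (hc : m ⋖ c) (hma : m ≤ a) (hmb : m ≤ b) (hca : ¬ c ≤ a)
    (hcb : ¬ c ≤ b) : a ≤ b ∨ b ≤ a := by
  have := hL.semimodular
  by_contra! h
  obtain ⟨a', ha', haa⟩ := hL.exists_covBy_le (inf_lt_left.2 h.1)
  obtain ⟨b', hb', hbb⟩ := hL.exists_covBy_le (inf_lt_right.2 h.2)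
  have hd : a ⊓ b ⋖ c ⊔ a ⊓ b := covBy_sup_of_covBy_of_not_le hc (le_inf hma hmb)
    fun h' => hca (h'.trans inf_le_left)
  rcases hL.eq_or_eq_or_eq_of_covBy ha' hb' hd with e | e | e
  · exact ha'.lt.not_ge (le_inf haa (e ▸ hbb))
  · exact hca ((le_sup_left.trans e.ge).trans haa)
  · exact hcb ((le_sup_left.trans e.ge).trans hbb)

theorem le_or_le_of_inf_eq_inf (hL : IsSPS L) (h : c ⊓ a = c ⊓ b) (hca : ¬ c ≤ a) :
    a ≤ b ∨ b ≤ a := by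
  obtain ⟨d, hd, hdc⟩ := hL.exists_covBy_le (inf_lt_left.2 hca)
  refine hL.le_or_le_of_not_le hd inf_le_right (h.trans_le inf_le_right) ?_ ?_
  · exact fun hda => hd.lt.not_ge (le_inf hdc hda)
  · exact fun hdb => hd.lt.not_ge (h.ge.trans' (le_inf hdc hdb))

theorem le_or_le_or_le_sup (hL : IsSPS L) (h : a ⊓ b ≤ c) : a ≤ c ∨ b ≤ c ∨ c ≤ a ⊔ b := by
  by_contra! hn
  obtain ⟨hac, hbc, hcab⟩ := hn
  have hca : ¬ c ≤ a := fun h' => hcab (h'.trans le_sup_left)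
  have hcb : ¬ c ≤ b := fun h' => hcab (h'.trans le_sup_right)
  have hab : ¬ a ≤ b := fun h' => hac ((le_inf le_rfl h').trans h)
  have hba : ¬ b ≤ a := fun h' => hbc ((le_inf h' le_rfl).trans h)
  rcases hL.planar.exists_middle ⟨hab, hba⟩ ⟨hac, hca⟩ ⟨hbc, hcb⟩ with k | k | k
  · exact hcab k.2
  · have e : a ⊓ b = a ⊓ c := le_antisymm (le_inf inf_le_left h) (le_inf inf_le_left k.1)
    exact (hL.le_or_le_of_inf_eq_inf e hab).elim hbc hcb
  · have e : b ⊓ a = b ⊓ c :=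
      le_antisymm (le_inf inf_le_left (inf_comm a b ▸ h)) (le_inf inf_le_left k.1)
    exact (hL.le_or_le_of_inf_eq_inf e hba).elim hac hca

end IsSPS

/-! ### The trace of a fork -/

lemma IsCoveringSquare.sup_eq {L : Type*} [Lattice L] {o a b i : L}
    (h : IsCoveringSquare o a b i) : a ⊔ b = i :=
  h.2.2.1.wcovBy.sup_eq h.2.2.2.1.wcovBy h.2.2.2.2

namespace ForkTrace

variable {L : Type*} [Lattice L] {o a b x y x' y' x'' y'' : L}

lemma left_le (h : ForkTrace o a y x) : y ≤ o := by
  induction h with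
  | base => rfl
  | step _ _ ih => exact inf_le_right.trans ih

lemma right_le (h : ForkTrace o a y x) : x ≤ a := by
  induction h with
  | base => rfl
  | step _ hT ih => exact hT.2.2.1.le.trans ih

lemma le_sup (h : ForkTrace o a y x) : a ≤ o ⊔ x := by
  induction h with
  | base => exact le_sup_right
  | step h hT ih =>
    exact ih.trans (sup_le le_sup_left
      (hT.sup_eq.ge.trans (sup_le le_sup_right (h.left_le.trans le_sup_left))))

lemma covBy (h : ForkTrace o a y x) (hoa : o ⋖ a) : y ⋖ x := by
  cases h with
  | base => exact hoa
  | step h hT => exact hT.1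

lemma not_le (h : ForkTrace o a y x) (hoa : o ⋖ a) : ¬ x ≤ o :=
  fun hx => hoa.lt.not_ge (h.le_sup.trans (sup_le le_rfl hx))

lemma inf_eq (h : ForkTrace o a y x) (hoa : o ⋖ a) : x ⊓ o = y :=
  inf_eq_of_covBy_of_not_le (h.covBy hoa) h.left_le (h.not_le hoa)

section IsSPS

variable (hL : IsSPS L) (hoa : o ⋖ a)
include hL hoa

lemma le_of_inf_lt (h : ForkTrace o a y x) (hT : IsCoveringSquare (x' ⊓ y) x' y x)
    (hlt : x' ⊓ y < b) (hbo : b ≤ o) : y ≤ b :=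
  (hL.le_or_le_of_lt hT.1 hT.2.1 hT.2.2.2.2 hlt).resolve_left fun h' =>
    (h.step hT).not_le hoa (h'.trans hbo)

lemma sup (h : ForkTrace o a y x) (hyb : y ≤ b) (hbo : b ≤ o) : ForkTrace o a b (b ⊔ x) := by
  induction h with
  | base =>
    obtain rfl := le_antisymm hyb hbo
    rw [sup_eq_right.2 hoa.le]
    exact .base
  | @step y x x' h hT ih =>
    rcases hyb.eq_or_lt with rfl | hlt
    · rw [sup_eq_right.2 inf_le_left]
      exact h.step hT
    · have hyb := le_of_inf_lt hL hoa h hT hlt hbo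
      have hsup : b ⊔ x = b ⊔ x' := by
        rw [← hT.sup_eq, sup_left_comm, sup_eq_left.2 hyb, sup_comm]
      exact hsup ▸ ih hyb

lemma le_of_lt (h : ForkTrace o a y x) (hT : IsCoveringSquare (x' ⊓ y) x' y x)
    (h'' : ForkTrace o a y'' x'') (hlt : x' < x'') : x ≤ x'' := by
  have hle : x' ⊓ y ≤ y'' := by
    rw [← (h.step hT).inf_eq hoa, ← h''.inf_eq hoa]
    exact inf_le_inf_right _ hlt.le
  rcases hle.eq_or_lt with rfl | hlt'
  · exact absurd hlt ((h''.covBy hoa).2 hT.1.lt)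
  · rw [← hT.sup_eq]
    exact sup_le hlt.le
      ((le_of_inf_lt hL hoa h hT hlt' h''.left_le).trans (h''.covBy hoa).le)

lemma left_sup_left {a' : L} (hoa' : o ⋖ a') (hne : a ≠ a') (h : ForkTrace o a y x)
    (h' : ForkTrace o a' y' x') : y ⊔ y' = o := by
  have hle : y ⊔ y' ≤ o := sup_le h.left_le h'.left_le
  have k := h.sup hL hoa le_sup_left hle
  have k' := h'.sup hL hoa' le_sup_right hle
  by_contra hlt
  have not_le : ¬ a ≤ a' := not_le_of_covBy_of_covBy hoa hoa' hne
  have hxx : y ⊔ y' ⊔ x ≠ y ⊔ y' ⊔ x' := fun e =>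
    not_le (k.le_sup.trans (sup_le hoa'.le (e ▸ k'.right_le)))
  rcases hL.le_or_le_of_lt (k.covBy hoa) (k'.covBy hoa') hxx (hle.lt_of_ne hlt) with h | h
  · exact k.not_le hoa h
  · exact k'.not_le hoa' h

lemma sup_sup (h : ForkTrace o a y x) (h' : ForkTrace o a y' x') :
    ForkTrace o a (y ⊔ y') (x ⊔ x') := by
  have hle : y ⊔ y' ≤ o := sup_le h.left_le h'.left_le
  have k := h.sup hL hoa le_sup_left hle
  have k' := h'.sup hL hoa le_sup_right hle
  have hxx : y ⊔ y' ⊔ x = y ⊔ y' ⊔ x' := by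
    by_contra hne
    rcases hle.eq_or_lt with he | hlt
    · have eq_a {z : L} (hz : ForkTrace o a (y ⊔ y') (y ⊔ y' ⊔ z)) : y ⊔ y' ⊔ z = a :=
        hz.right_le.antisymm (hz.le_sup.trans (sup_le (he ▸ le_sup_left) le_rfl))
      exact hne ((eq_a k).trans (eq_a k').symm)
    · rcases hL.le_or_le_of_lt (k.covBy hoa) (k'.covBy hoa) hne hlt with h | h
      · exact k.not_le hoa h
      · exact k'.not_le hoa h
  have hsup : x ⊔ x' = y ⊔ y' ⊔ x :=
    le_antisymm (sup_le le_sup_right (hxx ▸ le_sup_right))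
      (sup_le (sup_le_sup (h.covBy hoa).le (h'.covBy hoa).le) le_sup_left)
  rwa [hsup]

lemma exists_le (hba : b ≤ a) (hbo : ¬ b ≤ o) : ∃ y x, ForkTrace o a y x ∧ x ≤ b := by
  have := hL.planar.1
  have := hL.semimodular
  obtain ⟨w, hwb, hw⟩ := exists_minimal_le_of_wellFoundedLT (¬ · ≤ o) b hbo
  have hcov : w ⊓ o ⋖ w :=
    ⟨inf_lt_left.2 hw.prop, fun v hv hvw =>
      hv.not_ge (le_inf hvw.le (not_not.1 (hw.not_prop_of_lt hvw)))⟩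
  obtain ⟨x, -, ⟨⟨y, hyx⟩, hwx⟩, hmin⟩ := exists_minimal_le_of_wellFoundedLT
    (fun x => (∃ y, ForkTrace o a y x) ∧ w ≤ x) a ⟨⟨o, .base⟩, hwb.trans hba⟩
  refine ⟨y, x, hyx, ?_⟩
  rcases hwx.eq_or_lt with rfl | hlt
  · exact hwb
  · have hinf : w ⊓ y = w ⊓ o := by rw [← hyx.inf_eq hoa, ← inf_assoc, inf_eq_left.2 hwx]
    obtain ⟨x', hwx', hT⟩ := exists_isCoveringSquare_of_inf_covBy (hyx.covBy hoa) hlt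
      (fun h => hw.prop (h.trans hyx.left_le)) (by rwa [hinf])
    exact absurd (hmin ⟨⟨_, hyx.step hT⟩, hwx'⟩ hT.2.2.1.le) hT.2.2.1.lt.not_ge

end IsSPS

end ForkTrace

/-! ### The lattice `L[S]` -/

section Finite

variable {α : Type*} [Finite α] [SemilatticeSup α] [IsCodirectedOrder α]

lemma exists_isGLB_pair (a b : α) : ∃ c, IsGLB {a, b} c := by
  obtain ⟨d, hda, hdb⟩ := exists_le_le a b
  have hd : d ∈ lowerBounds {a, b} := by simp [hda, hdb]
  have hfin := (lowerBounds {a, b}).toFinite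
  have hlub := Finset.isLUB_sup' (s := hfin.toFinset) ⟨d, hfin.mem_toFinset.2 hd⟩
  rw [hfin.coe_toFinset] at hlub
  exact ⟨_, isLUB_lowerBounds.1 hlub⟩

/-- The lattice structure of a finite join-semilattice in which any two elements have a common lower
bound. -/
noncomputable abbrev latticeOfFiniteSemilatticeSup : Lattice α where
  inf a b := (exists_isGLB_pair a b).choose
  inf_le_left a b := (exists_isGLB_pair a b).choose_spec.1 (Set.mem_insert a {b})
  inf_le_right a b := (exists_isGLB_pair a b).choose_spec.1 (Set.mem_insert_of_mem a rfl)
  le_inf a b c hab hac := (exists_isGLB_pair b c).choose_spec.2 (by simp [hab, hac])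

end Finite

namespace CoveringSquare

variable {L : Type*} [Lattice L] (S : CoveringSquare L) {s s' : Bool}

/-- The two middle elements of a covering square, indexed by the two sides: `true` stands for left
and `false` for right. -/
def side : Bool → L
  | true => S.al
  | false => S.ar

lemma o_covBy_side (s : Bool) : S.o ⋖ S.side s := by
  cases s
  exacts [S.isCoveringSquare.2.1, S.isCoveringSquare.1]

lemma side_covBy_i (s : Bool) : S.side s ⋖ S.i := by
  cases s
  exacts [S.isCoveringSquare.2.2.2.1, S.isCoveringSquare.2.2.1]

lemma o_lt_i : S.o < S.i := (S.o_covBy_side true).lt.trans (S.side_covBy_i true).lt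

lemma side_injective : Function.Injective S.side :=
  Bool.injective_iff.2 S.isCoveringSquare.2.2.2.2.symm

lemma side_inf_side (h : s ≠ s') : S.side s ⊓ S.side s' = S.o :=
  (S.o_covBy_side s).wcovBy.inf_eq (S.o_covBy_side s').wcovBy (S.side_injective.ne h)

lemma side_sup_side (h : s ≠ s') : S.side s ⊔ S.side s' = S.i :=
  (S.side_covBy_i s).wcovBy.sup_eq (S.side_covBy_i s').wcovBy (S.side_injective.ne h)

end CoveringSquare

namespace Fork

variable {L : Type*} [Lattice L] {S : CoveringSquare L} {s s' : Bool} {a b x x' y y' : L}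
  {u v : Fork S}

/-- The new elements `z_{l,k}` and `z_{r,k}` of `L[S]`, for both sides `s` at once. -/
def z : (s : Bool) → {y x : L} → ForkTrace S.o (S.side s) y x → Fork S
  | true, y, x, h => zl y x h
  | false, y, x, h => zr y x h

@[elab_as_elim]
lemma cases_old_t_z {motive : Fork S → Prop} (u : Fork S) (old : ∀ a, motive (old a))
    (t : motive t) (z : ∀ s y x, ∀ h : ForkTrace S.o (S.side s) y x, motive (z s h)) :
    motive u := by
  cases u with
  | old a => exact old a
  | t => exact t
  | zl y x h => exact z true y x h
  | zr y x h => exact z false y x h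

/-- The coordinates of an element `u` of `L[S]` in the product of `L` with a two-element chain: the
least element of `L` above `u`, and whether `u ≰ t` (see `le_t_iff`). -/
def coord : Fork S → L × Prop
  | old a => (a, ¬ a ≤ S.o)
  | t => (S.i, False)
  | zl _ x _ => (x, False)
  | zr _ x _ => (x, False)

/-- The least element of `L` above an element of `L[S]`. -/
def ceil (u : Fork S) : L := u.coord.1

@[simp] lemma ceil_old : ceil (old a : Fork S) = a := rfl

@[simp] lemma ceil_t : ceil (t : Fork S) = S.i := rfl

@[simp] lemma ceil_z (h : ForkTrace S.o (S.side s) y x) : ceil (z s h) = x := by cases s <;> rfl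

lemma Step.eq_or_coord_lt (h : Step S u v) : u = v ∨ u.coord < v.coord := by
  have false_lt {p : Prop} (hp : p) : False < p := ⟨False.elim, fun h => h hp⟩
  have lt_x {s : Bool} {y x : L} (h : ForkTrace S.o (S.side s) y x) :
      (x, False) < (x, ¬ x ≤ S.o) :=
    Prod.mk_lt_mk_iff_right.2 (false_lt (h.not_le (S.o_covBy_side s)))
  have y_lt {s : Bool} {y x : L} (h : ForkTrace S.o (S.side s) y x) :
      (y, ¬ y ≤ S.o) < (x, False) :=
    Prod.lt_iff.2 (.inl ⟨(h.covBy (S.o_covBy_side s)).lt, fun hy => hy h.left_le⟩)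
  have lt_of_lt {b c : L} (hbc : b < c) : (b, False) < (c, False) :=
    Prod.mk_lt_mk_iff_left.2 hbc
  cases h with
  | @old a b hab =>
    rcases hab.eq_or_lt with rfl | hlt
    · exact .inl rfl
    · exact .inr (Prod.lt_iff.2 (.inl ⟨hlt, fun ha hb => ha (hab.trans hb)⟩))
  | t_lt_i => exact .inr (Prod.mk_lt_mk_iff_right.2 (false_lt S.o_lt_i.not_ge))
  | zl_lt_t => exact .inr (lt_of_lt (S.side_covBy_i true).lt)
  | zr_lt_t => exact .inr (lt_of_lt (S.side_covBy_i false).lt)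
  | y_lt_zl h => exact .inr (y_lt (s := true) h)
  | y_lt_zr h => exact .inr (y_lt (s := false) h)
  | zl_lt_x h => exact .inr (lt_x (s := true) h)
  | zr_lt_x h => exact .inr (lt_x (s := false) h)
  | zl_lt_zl h hT => exact .inr (lt_of_lt hT.2.2.1.lt)
  | zr_lt_zr h hT => exact .inr (lt_of_lt hT.2.2.1.lt)

lemma Le.eq_or_coord_lt (h : Le u v) : u = v ∨ u.coord < v.coord := by
  induction h with
  | refl => exact .inl rfl
  | tail _ hstep ih =>
    rcases ih with rfl | hlt
    · exact hstep.eq_or_coord_lt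
    · rcases hstep.eq_or_coord_lt with rfl | hlt'
      · exact .inr hlt
      · exact .inr (hlt.trans hlt')

scoped instance instPartialOrder : PartialOrder (Fork S) where
  le := Le
  le_refl _ := .refl
  le_trans _ _ _ := .trans
  le_antisymm _ _ huv hvu :=
    huv.eq_or_coord_lt.elim id fun hlt => (hvu.eq_or_coord_lt.resolve_right hlt.not_gt).symm

lemma Step.le (h : Step S u v) : u ≤ v := .single h

lemma coord_mono : Monotone (coord (S := S)) := fun _ _ h =>
  (Le.eq_or_coord_lt h).elim (fun e => e ▸ le_rfl) le_of_lt

lemma old_le_z (h : ForkTrace S.o (S.side s) y x) : old y ≤ z s h := by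
  cases s
  exacts [(Step.y_lt_zr h).le, (Step.y_lt_zl h).le]

lemma z_le_old (h : ForkTrace S.o (S.side s) y x) : z s h ≤ old x := by
  cases s
  exacts [(Step.zr_lt_x h).le, (Step.zl_lt_x h).le]

lemma z_step_le_z (h : ForkTrace S.o (S.side s) y x) (hT : IsCoveringSquare (x' ⊓ y) x' y x) :
    z s (h.step hT) ≤ z s h := by
  cases s
  exacts [(Step.zr_lt_zr h hT).le, (Step.zl_lt_zl h hT).le]

lemma z_le_t (h : ForkTrace S.o (S.side s) y x) : z s h ≤ t := by
  induction h with
  | base =>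
    cases s
    exacts [Step.zr_lt_t.le, Step.zl_lt_t.le]
  | step h hT ih => exact (z_step_le_z h hT).trans ih

lemma le_old_ceil (u : Fork S) : u ≤ old u.ceil := by
  cases u using cases_old_t_z with
  | old a => exact le_rfl
  | t => exact Step.t_lt_i.le
  | z s y x h =>
    rw [ceil_z]
    exact z_le_old h

lemma gc_ceil_old : GaloisConnection (ceil (S := S)) old := fun u _ =>
  ⟨fun h => (le_old_ceil u).trans (Step.old h).le, fun h => (coord_mono h).1⟩

lemma ceil_mono : Monotone (ceil (S := S)) := gc_ceil_old.monotone_l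

@[simp] lemma old_le_old_iff : (old a : Fork S) ≤ old b ↔ a ≤ b := (gc_ceil_old _ _).symm

lemma le_t_iff : u ≤ t ↔ ¬ u.coord.2 := by
  refine ⟨fun h => (coord_mono h).2, fun h => ?_⟩
  cases u using cases_old_t_z with
  | old a =>
    exact (Step.old (not_not.1 h)).le.trans ((old_le_z (s := true) .base).trans (z_le_t _))
  | t => exact le_rfl
  | z s y x k => exact z_le_t k

@[simp] lemma old_le_t_iff : (old a : Fork S) ≤ t ↔ a ≤ S.o := le_t_iff.trans not_not

lemma old_ceil_of_not_le_t (h : ¬ u ≤ t) : old u.ceil = u := by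
  cases u using cases_old_t_z with
  | old a => rfl
  | t => exact absurd le_rfl h
  | z s y x k => exact absurd (z_le_t k) h

lemma exists_old_le (u : Fork S) : ∃ a, old a ≤ u := by
  cases u using cases_old_t_z with
  | old a => exact ⟨a, le_rfl⟩
  | t => exact ⟨S.o, old_le_t_iff.2 le_rfl⟩
  | z s y x h => exact ⟨y, old_le_z h⟩

scoped instance instIsCodirectedOrder : IsCodirectedOrder (Fork S) where
  directed u v := by
    obtain ⟨a, ha⟩ := exists_old_le u
    obtain ⟨b, hb⟩ := exists_old_le v
    exact ⟨old (a ⊓ b), (old_le_old_iff.2 inf_le_left).trans ha,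
      (old_le_old_iff.2 inf_le_right).trans hb⟩

@[simp] lemma old_lt_old_iff : (old a : Fork S) < old b ↔ a < b := by
  simp [lt_iff_le_not_ge]

lemma old_covBy_old (ha : ¬ a ≤ S.o) (hab : a ⋖ b) : (old a : Fork S) ⋖ old b := by
  refine ⟨old_lt_old_iff.2 hab.lt, fun v hav hvb => ?_⟩
  have hvt : ¬ v ≤ t := fun h => ha (old_le_t_iff.1 (hav.le.trans h))
  rw [← old_ceil_of_not_le_t hvt, old_lt_old_iff] at hav hvb
  exact hab.2 hav hvb

lemma old_side_covBy_old_i (s : Bool) : (old (S.side s) : Fork S) ⋖ old S.i :=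
  old_covBy_old (S.o_covBy_side s).lt.not_ge (S.side_covBy_i s)

lemma t_covBy_old_i : (t : Fork S) ⋖ old S.i := by
  refine ⟨(le_old_ceil t).lt_of_not_ge fun h => S.o_lt_i.not_ge (old_le_t_iff.1 h), ?_⟩
  intro v htv hvi
  rw [← old_ceil_of_not_le_t htv.not_ge, old_lt_old_iff] at hvi
  exact hvi.not_ge (ceil_mono htv.le)

section IsSPS

variable [hL : Fact (IsSPS L)]

lemma z_le_z (h : ForkTrace S.o (S.side s) y x) (h' : ForkTrace S.o (S.side s) y' x')
    (hle : x ≤ x') : z s h ≤ z s h' := by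
  have hs := S.o_covBy_side s
  have eq_of_eq {y x : L} (h : ForkTrace S.o (S.side s) y x) (e : x = x') : z s h ≤ z s h' := by
    subst e
    obtain rfl := (h.inf_eq hs).symm.trans (h'.inf_eq hs)
    rfl
  induction h with
  | base => exact eq_of_eq .base (hle.antisymm h'.right_le)
  | step h hT ih =>
    rcases hle.eq_or_lt with e | hlt
    · exact eq_of_eq _ e
    · exact (z_step_le_z h hT).trans (ih (h.le_of_lt hL.out hs hT h' hlt))

lemma le_of_ceil_le_ceil (hu : u ≤ t) (h : u.ceil ≤ v.ceil) : u ≤ v := by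
  cases v using cases_old_t_z with
  | old b => exact (gc_ceil_old _ _).1 h
  | t => exact hu
  | z s y x k =>
    rw [ceil_z] at h
    cases u using cases_old_t_z with
    | old a =>
      have hay : a ≤ y := (le_inf h (old_le_t_iff.1 hu)).trans_eq (k.inf_eq (S.o_covBy_side s))
      exact (old_le_old_iff.2 hay).trans (old_le_z k)
    | t => exact absurd (h.trans k.right_le) (S.side_covBy_i s).lt.not_ge
    | z s' y' x' k' =>
      rw [ceil_z] at h
      rcases eq_or_ne s s' with rfl | hne
      · exact z_le_z k' k h
      · exact absurd ((le_inf (h.trans k.right_le) k'.right_le).trans_eq (S.side_inf_side hne))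
          (k'.not_le (S.o_covBy_side s'))

theorem le_iff : u ≤ v ↔ u.ceil ≤ v.ceil ∧ (v ≤ t → u ≤ t) := by
  refine ⟨fun h => ⟨ceil_mono h, h.trans⟩, fun ⟨hceil, ht⟩ => ?_⟩
  by_cases hv : v ≤ t
  · exact le_of_ceil_le_ceil (ht hv) hceil
  · rw [← old_ceil_of_not_le_t hv]
    exact (gc_ceil_old _ _).1 hceil

scoped instance instFinite : Finite (Fork S) := by
  have := hL.out.planar.1
  refine .of_injective (fun u : Fork S => (u.ceil, u ≤ t)) fun u v h => ?_
  obtain ⟨hceil, ht⟩ := Prod.mk.inj h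
  exact (le_iff.2 ⟨hceil.le, ht.mpr⟩).antisymm (le_iff.2 ⟨hceil.ge, ht.mp⟩)

lemma exists_ceil_eq_sup_of_trace_old (h : ForkTrace S.o (S.side s) y x) (ha : a ≤ S.o) :
    ∃ w ≤ (t : Fork S), w.ceil = x ⊔ a := by
  have hs := S.o_covBy_side s
  refine ⟨_, z_le_t (h.sup hL.out hs le_sup_right (sup_le ha h.left_le)), ?_⟩
  rw [ceil_z, sup_assoc, sup_eq_right.2 (h.covBy hs).le, sup_comm]

lemma sup_eq_i_of_trace_of_trace (hne : s ≠ s') (h : ForkTrace S.o (S.side s) y x)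
    (h' : ForkTrace S.o (S.side s') y' x') : x ⊔ x' = S.i := by
  have hs := S.o_covBy_side s
  have hs' := S.o_covBy_side s'
  have ho : S.o ≤ x ⊔ x' := by
    rw [← h.left_sup_left hL.out hs hs' (S.side_injective.ne hne) h']
    exact sup_le_sup (h.covBy hs).le (h'.covBy hs').le
  refine le_antisymm (sup_le ?_ ?_) ?_
  · exact h.right_le.trans (S.side_covBy_i s).le
  · exact h'.right_le.trans (S.side_covBy_i s').le
  · rw [← S.side_sup_side hne]
    exact sup_le (h.le_sup.trans (sup_le ho le_sup_left))
      (h'.le_sup.trans (sup_le ho le_sup_right))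

lemma exists_ceil_eq_sup_of_trace_trace (h : ForkTrace S.o (S.side s) y x)
    (h' : ForkTrace S.o (S.side s') y' x') : ∃ w ≤ (t : Fork S), w.ceil = x ⊔ x' := by
  rcases eq_or_ne s s' with rfl | hne
  · exact ⟨_, z_le_t (h.sup_sup hL.out (S.o_covBy_side s) h'), ceil_z _⟩
  · exact ⟨t, le_rfl, (sup_eq_i_of_trace_of_trace hne h h').symm⟩

lemma exists_ceil_eq_sup (hu : u ≤ t) (hv : v ≤ t) :
    ∃ w ≤ (t : Fork S), w.ceil = u.ceil ⊔ v.ceil := by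
  cases u using cases_old_t_z with
  | t => exact ⟨t, le_rfl, (sup_eq_left.2 (ceil_mono hv)).symm⟩
  | old a =>
    cases v using cases_old_t_z with
    | t => exact ⟨t, le_rfl, (sup_eq_right.2 (ceil_mono hu)).symm⟩
    | old b => exact ⟨old (a ⊔ b), by simp_all, rfl⟩
    | z s y x h =>
      rw [ceil_old, ceil_z, sup_comm]
      exact exists_ceil_eq_sup_of_trace_old h (old_le_t_iff.1 hu)
  | z s y x h =>
    rw [ceil_z]
    cases v using cases_old_t_z with
    | t => exact ⟨t, le_rfl, (sup_eq_right.2 (h.right_le.trans (S.side_covBy_i s).le)).symm⟩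
    | old b => exact exists_ceil_eq_sup_of_trace_old h (old_le_t_iff.1 hv)
    | z s' y' x' h' =>
      rw [ceil_z]
      exact exists_ceil_eq_sup_of_trace_trace h h'

lemma exists_isLUB_pair (u v : Fork S) : ∃ w, IsLUB {u, v} w := by
  suffices ∃ w, ∀ x, w ≤ x ↔ u ≤ x ∧ v ≤ x by simpa [isLUB_iff_le_iff]
  by_cases h : u ≤ t ∧ v ≤ t
  · obtain ⟨w, hwt, hw⟩ := exists_ceil_eq_sup h.1 h.2
    refine ⟨w, fun x => ⟨fun hwx => ⟨?_, ?_⟩, fun hx => ?_⟩⟩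
    · exact (le_of_ceil_le_ceil h.1 (hw ▸ le_sup_left)).trans hwx
    · exact (le_of_ceil_le_ceil h.2 (hw ▸ le_sup_right)).trans hwx
    · exact le_of_ceil_le_ceil hwt (hw ▸ sup_le (ceil_mono hx.1) (ceil_mono hx.2))
  · refine ⟨old (u.ceil ⊔ v.ceil), fun x => ⟨fun hx => ⟨?_, ?_⟩, fun hx => ?_⟩⟩
    · exact ((gc_ceil_old _ _).1 le_sup_left).trans hx
    · exact ((gc_ceil_old _ _).1 le_sup_right).trans hx
    · rw [← old_ceil_of_not_le_t fun hxt => h ⟨hx.1.trans hxt, hx.2.trans hxt⟩]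
      exact old_le_old_iff.2 (sup_le (ceil_mono hx.1) (ceil_mono hx.2))

noncomputable scoped instance instSemilatticeSup : SemilatticeSup (Fork S) where
  sup u v := (exists_isLUB_pair u v).choose
  le_sup_left u v := (exists_isLUB_pair u v).choose_spec.1 (Set.mem_insert u {v})
  le_sup_right u v := (exists_isLUB_pair u v).choose_spec.1 (Set.mem_insert_of_mem u rfl)
  sup_le u v w huw hvw := (exists_isLUB_pair u v).choose_spec.2 (by simp [huw, hvw])

noncomputable scoped instance instLattice : Lattice (Fork S) := latticeOfFiniteSemilatticeSup

lemma ceil_sup (u v : Fork S) : (u ⊔ v).ceil = u.ceil ⊔ v.ceil := gc_ceil_old.l_sup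

lemma old_inf (a b : L) : (old (a ⊓ b) : Fork S) = old a ⊓ old b := gc_ceil_old.u_inf

lemma old_sup_of_not_le (hb : ¬ b ≤ S.o) (u : Fork S) : old b ⊔ u = old (b ⊔ u.ceil) := by
  rw [← old_ceil_of_not_le_t (u := old b ⊔ u), ceil_sup, ceil_old]
  exact fun h => hb (old_le_t_iff.1 (le_sup_left.trans h))

lemma t_inf_old_ceil (hu : u ≤ t) : t ⊓ old u.ceil = u :=
  le_antisymm (le_of_ceil_le_ceil inf_le_left (gc_ceil_old _ _ |>.2 inf_le_right))
    (le_inf hu (le_old_ceil u))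

end IsSPS

end Fork

/-! ### Congruences of a lattice -/

section LatticeCon

open LatticeCon

variable {K : Type*} [Lattice K] {θ φ : LatticeCon K} {p q x y : K}

lemma con_rel_self (a b : K) : (con a b).r a b := fun _ hθ => hθ

lemma con_le_iff_rel {a b : K} : con a b ≤ θ ↔ θ.r a b :=
  ⟨fun h => h _ _ (con_rel_self a b), fun h _ _ hxy => hxy θ h⟩

lemma rel_inf_right (h : θ.r x y) (z : K) : θ.r (x ⊓ z) (y ⊓ z) := θ.inf h (θ.refl z)

lemma rel_sup_right (h : θ.r x y) (z : K) : θ.r (x ⊔ z) (y ⊔ z) := θ.sup h (θ.refl z)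

lemma latticeCon_le_of_forall_le (h : ∀ x y, x ≤ y → θ.r x y → φ.r x y) : θ ≤ φ := fun _ _ hxy =>
  φ.r_inf_sup_iff.1 (h _ _ inf_le_sup (θ.r_inf_sup_iff.2 hxy))

/-- The congruence given by an equivalence relation compatible with meets and joins with a fixed
element. -/
def latticeConOfUnary (e : Setoid K) (inf : ∀ x y z, e x y → e (x ⊓ z) (y ⊓ z))
    (sup : ∀ x y z, e x y → e (x ⊔ z) (y ⊔ z)) : LatticeCon K where
  toSetoid := e
  inf {w x y z} h h' := e.trans (inf w x y h) (inf_comm y x ▸ inf_comm z x ▸ inf y z x h')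
  sup {w x y z} h h' := e.trans (sup w x y h) (sup_comm y x ▸ sup_comm z x ▸ sup y z x h')

theorem latticeCon_toSetoid_sup (θ φ : LatticeCon K) :
    (θ ⊔ φ).toSetoid = θ.toSetoid ⊔ φ.toSetoid := by
  have compat (f : K → K) (hθ : ∀ x y, θ.r x y → θ.r (f x) (f y))
      (hφ : ∀ x y, φ.r x y → φ.r (f x) (f y)) :
      θ.toSetoid ⊔ φ.toSetoid ≤ (θ.toSetoid ⊔ φ.toSetoid).comap f :=
    sup_le (fun {x y} h => le_sup_left (a := θ.toSetoid) (hθ x y h))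
      (fun {x y} h => le_sup_right (a := θ.toSetoid) (hφ x y h))
  let ψ : LatticeCon K := latticeConOfUnary (θ.toSetoid ⊔ φ.toSetoid)
    (fun _ _ z h => compat (· ⊓ z) (fun _ _ h => rel_inf_right h z)
      (fun _ _ h => rel_inf_right h z) h)
    (fun _ _ z h => compat (· ⊔ z) (fun _ _ h => rel_sup_right h z)
      (fun _ _ h => rel_sup_right h z) h)
  refine le_antisymm ?_ (sup_le ?_ ?_)
  · have hψ : θ ⊔ φ ≤ ψ := sup_le (fun x y h => le_sup_left (a := θ.toSetoid) h)
      (fun x y h => le_sup_right (a := θ.toSetoid) h)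
    exact fun {x y} h => hψ x y h
  · exact fun {x y} h => (le_sup_left : θ ≤ θ ⊔ φ) x y h
  · exact fun {x y} h => (le_sup_right : φ ≤ θ ⊔ φ) x y h

lemma latticeCon_toSetoid_le_ker (hpq : p ⋖ q) (h : ¬ θ.r p q) :
    θ.toSetoid ≤ Setoid.ker fun x => (x ⊔ p) ⊓ q := by
  intro x y hxy
  have rel := rel_inf_right (rel_sup_right hxy p) q
  have eq_or_eq (z : K) : (z ⊔ p) ⊓ q = p ∨ (z ⊔ p) ⊓ q = q :=
    hpq.eq_or_eq (le_inf le_sup_right hpq.le) inf_le_right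
  rw [Setoid.ker_def]
  rcases eq_or_eq x with hx | hx <;> rcases eq_or_eq y with hy | hy <;> rw [hx, hy] at rel ⊢
  · exact absurd rel h
  · exact absurd (θ.symm rel) h

theorem rel_or_rel_of_sup_rel (hpq : p ⋖ q) (h : (θ ⊔ φ).r p q) : θ.r p q ∨ φ.r p q := by
  by_contra! hn
  have hker := sup_le (latticeCon_toSetoid_le_ker hpq hn.1) (latticeCon_toSetoid_le_ker hpq hn.2)
  rw [← latticeCon_toSetoid_sup] at hker
  have e : (p ⊔ p) ⊓ q = (q ⊔ p) ⊓ q := hker h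
  rw [sup_idem, inf_eq_left.2 hpq.le, sup_eq_left.2 hpq.le, inf_idem] at e
  exact hpq.ne e

theorem supIrred_con (hpq : p ⋖ q) : SupIrred (con p q) := by
  refine ⟨fun hmin => ?_, fun θ φ h => ?_⟩
  · let eqCon : LatticeCon K := LatticeCon.ker (LatticeHom.id K)
    have hle : eqCon ≤ con p q := fun x y (h : x = y) => h ▸ (con p q).refl x
    exact hpq.ne (hmin hle p q (con_rel_self p q))
  · refine (rel_or_rel_of_sup_rel hpq (h ▸ con_rel_self p q)).imp ?_ ?_
    · exact fun hθ => (h ▸ le_sup_left : θ ≤ con p q).antisymm (con_le_iff_rel.2 hθ)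
    · exact fun hφ => (h ▸ le_sup_right : φ ≤ con p q).antisymm (con_le_iff_rel.2 hφ)

end LatticeCon

/-! ### Congruences of `L[S]` -/

namespace CoveringSquare

variable {L : Type*} [Lattice L] {S : CoveringSquare L} {b m u v w : L} {s : Bool}

/-- The barriers of `S` are its two middle elements and the elements of `L` that are not properly
below its top. The congruence `barrierCon` compares elements of `L[S]` by the barriers above
them. -/
def IsBarrier (S : CoveringSquare L) (b : L) : Prop := b < S.i → ∃ s, b = S.side s

lemma isBarrier_side (S : CoveringSquare L) (s : Bool) : S.IsBarrier (S.side s) := fun _ => ⟨s, rfl⟩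

lemma IsBarrier.eq_side_of_le (hb : S.IsBarrier b) (h : b ≤ S.side s) : b = S.side s := by
  obtain ⟨s', rfl⟩ := hb (h.trans_lt (S.side_covBy_i s).lt)
  by_contra hne
  exact not_le_of_covBy_of_covBy (S.o_covBy_side s') (S.o_covBy_side s) hne h

lemma exists_side_le (hL : IsSPS L) (h : S.o < m) : ∃ s, S.side s ≤ m :=
  (hL.le_or_le_of_lt (S.o_covBy_side true) (S.o_covBy_side false)
    (S.side_injective.ne (by decide)) h).elim (⟨true, ·⟩) (⟨false, ·⟩)

lemma IsTight.exists_le_side (hS : S.IsTight) (hL : IsSPS L) (h : m < S.i) :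
    ∃ s, m ≤ S.side s := by
  have := hL.planar.1
  obtain ⟨c, hmc, hc⟩ := exists_le_covBy_of_lt h
  rcases (hS c).1 hc with rfl | rfl
  exacts [⟨true, hmc⟩, ⟨false, hmc⟩]

/-- Barrier equivalence: lying below the same barriers. -/
def barrierSetoid (S : CoveringSquare L) : Setoid L where
  r u v := ∀ b, S.IsBarrier b → (u ≤ b ↔ v ≤ b)
  iseqv := ⟨fun _ _ _ => .rfl, fun h b hb => (h b hb).symm,
    fun h h' b hb => (h b hb).trans (h' b hb)⟩

lemma IsTight.eq_or_exists_le_side (hS : S.IsTight) (hL : IsSPS L) (h : S.barrierSetoid u v) :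
    u = v ∨ ∃ s, u ≤ S.side s ∧ v ≤ S.side s := by
  by_cases hu : u < S.i
  · obtain ⟨s, hus⟩ := hS.exists_le_side hL hu
    exact .inr ⟨s, hus, (h _ (S.isBarrier_side s)).1 hus⟩
  · by_cases hv : v < S.i
    · obtain ⟨s, hvs⟩ := hS.exists_le_side hL hv
      exact .inr ⟨s, (h _ (S.isBarrier_side s)).2 hvs, hvs⟩
    · exact .inl (((h v fun h => absurd h hv).2 le_rfl).antisymm
        ((h u fun h => absurd h hu).1 le_rfl))

lemma IsTight.inf_le_of_barrierSetoid (hS : S.IsTight) (hL : IsSPS L) (h : S.barrierSetoid u v)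
    (hb : S.IsBarrier b) (hub : u ⊓ w ≤ b) : v ⊓ w ≤ b := by
  rcases hS.eq_or_exists_le_side hL h with rfl | ⟨s, hu, hv⟩
  · exact hub
  · have hinf : u ⊓ (v ⊓ w) ≤ b := (inf_le_inf_left u inf_le_right).trans hub
    rcases hL.le_or_le_or_le_sup hinf with hub | hvwb | hb_le
    · exact inf_le_left.trans ((h b hb).1 hub)
    · exact hvwb
    · rw [hb.eq_side_of_le (hb_le.trans (sup_le hu (inf_le_left.trans hv)))]
      exact inf_le_left.trans hv

end CoveringSquare

namespace Fork

open CoveringSquare LatticeCon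

variable {L : Type*} [Lattice L] [hL : Fact (IsSPS L)] {S : CoveringSquare L} {s s' : Bool}
  {b m : L} {u v : Fork S} {δ : LatticeCon (Fork S)}

lemma le_barrier_of_forall_ceil_le (hS : S.IsTight) (hb : S.IsBarrier b) (hm : m ≤ S.i)
    (h : ∀ w ≤ (t : Fork S), w.ceil ≤ m → w.ceil ≤ b) : m ≤ b := by
  rcases hm.eq_or_lt with rfl | hlt
  · exact h t le_rfl le_rfl
  by_cases hmo : m ≤ S.o
  · exact h (old m) (old_le_t_iff.2 hmo) le_rfl
  obtain ⟨s, hms⟩ := hS.exists_le_side hL.out hlt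
  have hs := S.o_covBy_side s
  obtain ⟨y, x, k, hxm⟩ := ForkTrace.exists_le hL.out hs hms hmo
  have hxb : x ≤ b := by simpa [hxm] using h (z s k) (z_le_t k)
  have hob : S.o ⊓ m ≤ b := h (old _) (old_le_t_iff.2 inf_le_left) inf_le_right
  rcases hL.out.le_or_le_or_le_sup hob with hob | hmb | hb_le
  · exact hms.trans (k.le_sup.trans (sup_le hob hxb))
  · exact hmb
  · rwa [hb.eq_side_of_le (hb_le.trans (sup_le hs.le hms))]

lemma ceil_inf_le_barrier_iff (hS : S.IsTight) (hb : S.IsBarrier b) :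
    (u ⊓ v).ceil ≤ b ↔ u.ceil ⊓ v.ceil ≤ b := by
  have of_le_t {u v : Fork S} (hu : u ≤ t) (h : (u ⊓ v).ceil ≤ b) : u.ceil ⊓ v.ceil ≤ b :=
    le_barrier_of_forall_ceil_le hS hb (inf_le_left.trans (ceil_mono hu)) fun w hw hwm =>
      (ceil_mono (le_inf (le_of_ceil_le_ceil hw (hwm.trans inf_le_left))
        (le_of_ceil_le_ceil hw (hwm.trans inf_le_right)))).trans h
  refine ⟨fun h => ?_, (le_inf (ceil_mono inf_le_left) (ceil_mono inf_le_right)).trans⟩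
  by_cases hu : u ≤ t
  · exact of_le_t hu h
  by_cases hv : v ≤ t
  · rw [inf_comm] at h ⊢
    exact of_le_t hv h
  · rwa [← old_ceil_of_not_le_t hu, ← old_ceil_of_not_le_t hv, ← old_inf] at h

/-- Barrier equivalence of the least elements of `L` above two elements of `L[S]`: a congruence
collapsing `t` and `i` but none of the middle elements of `S` with `i`. -/
noncomputable def barrierCon (hS : S.IsTight) : LatticeCon (Fork S) :=
  latticeConOfUnary (S.barrierSetoid.comap ceil)
    (fun u v w h b hb => by
      rw [ceil_inf_le_barrier_iff hS hb, ceil_inf_le_barrier_iff hS hb]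
      exact ⟨hS.inf_le_of_barrierSetoid hL.out h hb,
        hS.inf_le_of_barrierSetoid hL.out (S.barrierSetoid.symm h) hb⟩)
    (fun u v w h b hb => by
      rw [ceil_sup, ceil_sup, sup_le_iff, sup_le_iff, h b hb])

theorem not_con_t_i_rel_side (hS : S.IsTight) (s : Bool) :
    ¬ (con t (old S.i)).r (old (S.side s) : Fork S) (old S.i) := fun h =>
  have hle : con t (old S.i) ≤ barrierCon hS := con_le_iff_rel.2 fun _ _ => .rfl
  (S.side_covBy_i s).lt.not_ge ((hle _ _ h _ (S.isBarrier_side s)).1 le_rfl)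

theorem rel_t_i_of_rel_side (h : δ.r (old (S.side s)) (old S.i)) : δ.r t (old S.i) := by
  have hi : S.side (!s) ≤ S.i := (S.side_covBy_i _).le
  have rel_o : δ.r (old S.o) (old (S.side !s)) := by
    have rel := rel_inf_right h (old (S.side !s))
    rwa [← old_inf, ← old_inf, S.side_inf_side (by simp), inf_eq_right.2 hi] at rel
  have rel := rel_sup_right rel_o t
  rwa [sup_eq_right.2 (old_le_t_iff.2 le_rfl), old_sup_of_not_le (S.o_covBy_side _).lt.not_ge,
    ceil_t, sup_eq_right.2 hi] at rel

theorem exists_rel_side_of_rel (hu : u.ceil ≤ S.o) (hv : ¬ v ≤ t) (h : δ.r u v) :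
    ∃ s, δ.r (old (S.side s)) (old S.i) := by
  set w := v ⊔ old S.o
  have hwt : ¬ w ≤ t := fun h => hv (le_sup_left.trans h)
  have rel_w : δ.r (old S.o) w := by
    have rel := rel_sup_right h (old S.o)
    rwa [sup_eq_right.2 ((gc_ceil_old _ _).1 hu)] at rel
  obtain ⟨s, hs⟩ : ∃ s, S.side s ≤ w.ceil := by
    refine exists_side_le hL.out (lt_of_le_not_ge ?_ fun hwo => hwt ?_)
    · exact (ceil_mono le_sup_right : (old S.o : Fork S).ceil ≤ w.ceil)
    · exact ((gc_ceil_old _ _).1 hwo).trans (old_le_t_iff.2 le_rfl)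
  have hsw : old (S.side s) ≤ w := old_ceil_of_not_le_t hwt ▸ old_le_old_iff.2 hs
  have rel_side : δ.r (old S.o) (old (S.side s)) := by
    have rel := rel_inf_right rel_w (old (S.side s))
    rwa [← old_inf, inf_eq_left.2 (S.o_covBy_side s).le, inf_eq_right.2 hsw] at rel
  have not_le_o (s : Bool) : ¬ S.side s ≤ S.o := (S.o_covBy_side s).lt.not_ge
  have rel := rel_sup_right rel_side (old (S.side !s))
  rw [old_sup_of_not_le (not_le_o s), sup_comm, old_sup_of_not_le (not_le_o _), ceil_old, ceil_old,
    sup_eq_left.2 (S.o_covBy_side _).le, S.side_sup_side (by simp)] at rel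
  exact ⟨!s, rel⟩

lemma inf_le_t_of_rel {w : Fork S} (hδ : ∀ u v, u.ceil ≤ S.o → δ.r u v → v ≤ t) (h : δ.r u v)
    (ht : u ≤ t ↔ v ≤ t) (huw : u ⊓ w ≤ t) : v ⊓ w ≤ t := by
  by_contra hvw
  have hu : ¬ u ≤ t := fun hu => hvw (inf_le_left.trans (ht.1 hu))
  have hw : ¬ w ≤ t := fun hw => hvw (inf_le_right.trans hw)
  refine hvw (hδ _ _ ?_ (rel_inf_right h w))
  rw [← old_ceil_of_not_le_t hu, ← old_ceil_of_not_le_t hw, ← old_inf] at huw ⊢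
  exact old_le_t_iff.1 huw

/-- The restriction of a congruence `δ` to the pairs not separated by the ideal of `t`. It is a
congruence as soon as `δ` separates the elements below `o` from those not below `t`. -/
noncomputable def restrictCon (δ : LatticeCon (Fork S))
    (hδ : ∀ u v, u.ceil ≤ S.o → δ.r u v → v ≤ t) : LatticeCon (Fork S) :=
  latticeConOfUnary
    { r := fun u v => δ.r u v ∧ (u ≤ t ↔ v ≤ t)
      iseqv := ⟨fun u => ⟨δ.refl u, .rfl⟩, fun h => ⟨δ.symm h.1, h.2.symm⟩,
        fun h h' => ⟨δ.trans h.1 h'.1, h.2.trans h'.2⟩⟩ }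
    (fun _ _ w h => ⟨rel_inf_right h.1 w, inf_le_t_of_rel hδ h.1 h.2,
      inf_le_t_of_rel hδ (δ.symm h.1) h.2.symm⟩)
    (fun _ _ w h => ⟨rel_sup_right h.1 w, by rw [sup_le_iff, sup_le_iff, h.2]⟩)

lemma con_t_i_rel_old_ceil (hu : u ≤ t) : (con t (old S.i)).r u (old u.ceil) := by
  have hi : u.ceil ≤ S.i := ceil_mono hu
  have rel := rel_inf_right (con_rel_self (t : Fork S) (old S.i)) (old u.ceil)
  rwa [t_inf_old_ceil hu, ← old_inf, inf_eq_right.2 hi] at rel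

theorem restrictCon_sup_con_t_i (hδ : ∀ u v, u.ceil ≤ S.o → δ.r u v → v ≤ t)
    (ht : δ.r t (old S.i)) : restrictCon δ hδ ⊔ con t (old S.i) = δ := by
  refine le_antisymm (sup_le (fun _ _ h => h.1) (con_le_iff_rel.2 ht)) ?_
  refine latticeCon_le_of_forall_le fun u v huv h => ?_
  have of_restrict {u v : Fork S} (h : δ.r u v) (ht : u ≤ t ↔ v ≤ t) :
      (restrictCon δ hδ ⊔ con t (old S.i)).r u v :=
    (le_sup_left : restrictCon δ hδ ≤ _) u v ⟨h, ht⟩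
  by_cases hiff : u ≤ t ↔ v ≤ t
  · exact of_restrict h hiff
  obtain ⟨hut, hvt⟩ : u ≤ t ∧ ¬ v ≤ t := by
    have := huv.trans (b := v) (c := t)
    tauto
  have hceil_v : old u.ceil ≤ v := old_ceil_of_not_le_t hvt ▸ old_le_old_iff.2 (ceil_mono huv)
  have rel_ceil : δ.r (old u.ceil) v := by
    have rel := rel_sup_right h (old u.ceil)
    rwa [sup_eq_right.2 (le_old_ceil u), sup_eq_left.2 hceil_v] at rel
  have hceil_t : ¬ old u.ceil ≤ t := fun h' => hvt (hδ u v (old_le_t_iff.1 h') h)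
  exact ((_ : LatticeCon _).trans
    ((le_sup_right : con t (old S.i) ≤ _) _ _ (con_t_i_rel_old_ceil hut))
    (of_restrict rel_ceil (iff_of_false hceil_t hvt)))

theorem eq_con_t_i_of_supIrred (hδ : SupIrred δ) (ht : δ.r t (old S.i))
    (hs : ∀ s, ¬ δ.r (old (S.side s)) (old S.i)) : δ = con t (old S.i) := by
  have hsep : ∀ u v, u.ceil ≤ S.o → δ.r u v → v ≤ t := fun u v hu h => by
    by_contra hv
    obtain ⟨s, rel⟩ := exists_rel_side_of_rel hu hv h
    exact hs s rel
  refine ((hδ.2 (restrictCon_sup_con_t_i hsep ht)).resolve_left fun e => ?_).symm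
  have hti : (restrictCon δ hsep).r t (old S.i) := e.symm ▸ ht
  exact S.o_lt_i.not_ge (old_le_t_iff.1 (hti.2.1 le_rfl))

end Fork

/-! ### The covers of `con(t, i)` -/

section PartialOrder

variable {α : Type*} [PartialOrder α] {a b g : α}

lemma setOf_covBy_eq_setOf_minimal (ha : g < a) (hb : g < b) (h : ∀ d, g < d → a ≤ d ∨ b ≤ d) :
    {d | g ⋖ d} = {d | Minimal (· ∈ ({a, b} : Set α)) d} := by
  have lt_of_mem {c : α} (hc : c ∈ ({a, b} : Set α)) : g < c := by
    rcases hc with rfl | rfl <;> assumption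
  have exists_mem_le {d : α} (hd : g < d) : ∃ c ∈ ({a, b} : Set α), c ≤ d := by
    simpa using h d hd
  ext d
  refine ⟨fun hd => ?_, fun hd => ⟨lt_of_mem hd.prop, fun c hgc hcd => ?_⟩⟩
  · obtain ⟨c, hc, hcd⟩ := exists_mem_le hd.lt
    obtain rfl := hcd.eq_of_not_lt (hd.2 (lt_of_mem hc))
    exact ⟨hc, fun e he hec => (hec.eq_of_not_lt (hd.2 (lt_of_mem he))).ge⟩
  · obtain ⟨e, he, hec⟩ := exists_mem_le hgc
    exact (hec.trans_lt hcd).not_ge (hd.2 he (hec.trans hcd.le))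

lemma ncard_setOf_minimal_pair (a b : α) :
    {d | Minimal (· ∈ ({a, b} : Set α)) d}.ncard = 1 ∨
      {d | Minimal (· ∈ ({a, b} : Set α)) d}.ncard = 2 := by
  have hfin : ({a, b} : Set α).Finite := Set.toFinite _
  have hsub : {d | Minimal (· ∈ ({a, b} : Set α)) d} ⊆ {a, b} := fun d hd => hd.prop
  have hpos := (Set.ncard_pos (hfin.subset hsub)).2 (hfin.exists_minimal ⟨a, .inl rfl⟩)
  have hle := (Set.ncard_le_ncard hsub hfin).trans (Set.ncard_insert_le a {b})
  rw [Set.ncard_singleton] at hle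
  omega

end PartialOrder

namespace Fork

open LatticeCon

variable {L : Type*} [Lattice L] [hL : Fact (IsSPS L)] {S : CoveringSquare L}

/-- The congruence `γ(S) = con(t, i)`, as an element of `Ji (Con L[S])`. -/
noncomputable def γ (S : CoveringSquare L) : JiCon (Fork S) :=
  ⟨con t (old S.i), supIrred_con t_covBy_old_i⟩

/-- The congruences `ᾱ_l(S) = con(a_l, i)` (for `s = true`) and `ᾱ_r(S) = con(a_r, i)` (for
`s = false`), as elements of `Ji (Con L[S])`. -/
noncomputable def α (S : CoveringSquare L) (s : Bool) : JiCon (Fork S) :=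
  ⟨con (old (S.side s)) (old S.i), supIrred_con (old_side_covBy_old_i s)⟩

lemma γ_lt_α (hS : S.IsTight) (s : Bool) : γ S < α S s :=
  lt_of_le_not_ge (con_le_iff_rel.2 (rel_t_i_of_rel_side (con_rel_self _ _)))
    fun h => not_con_t_i_rel_side hS s (con_le_iff_rel.1 h)

lemma exists_α_le_of_γ_lt {δ : JiCon (Fork S)} (h : γ S < δ) : ∃ s, α S s ≤ δ := by
  by_contra! hn
  exact h.ne (Subtype.ext (eq_con_t_i_of_supIrred δ.2 (con_le_iff_rel.1 h.le)
    fun s hs => hn s (con_le_iff_rel.2 hs)).symm)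

end Fork

theorem corollaryC {L : Type*} [Lattice L] (hL : IsSPS L) (S : CoveringSquare L)
    (hS : S.IsTight) :
    ∃ _ : Lattice (Fork S), (∀ u v : Fork S, u ≤ v ↔ Fork.Le u v) ∧
      ∃ γ αl αr : JiCon (Fork S),
        γ.1 = LatticeCon.con Fork.t (Fork.old S.i) ∧
        αl.1 = LatticeCon.con (Fork.old S.al) (Fork.old S.i) ∧
        αr.1 = LatticeCon.con (Fork.old S.ar) (Fork.old S.i) ∧
        {δ : JiCon (Fork S) | γ ⋖ δ} = {δ | Minimal (· ∈ ({αl, αr} : Set (JiCon (Fork S)))) δ} ∧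
        ({δ : JiCon (Fork S) | γ ⋖ δ}.ncard = 1 ∨ {δ : JiCon (Fork S) | γ ⋖ δ}.ncard = 2) := by
  have := Fact.mk hL
  have hcov := setOf_covBy_eq_setOf_minimal (Fork.γ_lt_α hS true) (Fork.γ_lt_α hS false)
    fun δ hδ => Bool.exists_bool.1 (Fork.exists_α_le_of_γ_lt hδ) |>.symm
  refine ⟨Fork.instLattice, fun _ _ => .rfl, Fork.γ S, Fork.α S true, Fork.α S false, rfl, rfl, rfl,
    hcov, ?_⟩
  rw [hcov]
  exact ncard_setOf_minimal_pair _ _
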